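/- Let $\mathbb X$ be a measurable space. A q-metric on a set $\Upsilon$ is a function $d:\Upsilon\times\Upsilon\to[0,\infty)$ such that $d(a,b)=0$ if and only if $a=b$, and $d(a,b)\le d(a,e)+d(e,b)$ for all $a,b,e\in\Upsilon$. Let $d_b$ be a measurable q-metric on $\mathbb X$, and let $c>0$, $1\le p<\infty$, $\gamma>0$, $\rho\in(0,1)$ and $T\in\mathbb N$. A trajectory is a pair $X=(\omega,x^{1:\nu})$ with integers $1\le\omega\le T$, $1\le\nu\le T-\omega+1$ and $x^{1:\nu}\in\mathbb X^\nu$; its set of objects at time $k\in\{1,\dots,T\}$ is $\{x^{k-\omega+1}\}$ if $\omega\le k\le\omega+\nu-1$ and $\emptyset$ otherwise. For sets $\mathbf x,\mathbf y\subseteq\mathbb X$ with at most one element put $$d_p^{(c,\rho)}(\mathbf x,\mathbf y)=\begin{cases}\min(c,d_b(x,y)) & \mathbf x=\{x\},\ \mathbf y=\{y\},\\ \rho^{1/p}c & \mathbf x=\emptyset,\ \mathbf y=\{y\},\\ (1-\rho)^{1/p}c & \mathbf x=\{x\},\ \mathbf y=\emptyset,\\ 0 & \mathbf x=\mathbf y=\emptyset.\end{cases}$$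 Let $\mathbf X=\{X_1,\dots,X_m\}$ and $\mathbf Y=\{Y_1,\dots,Y_n\}$ be finite sets of (distinct) trajectories, let $\mathbf x_i^k$, $\mathbf y_j^k$ be the sets of objects of $X_i$, $Y_j$ at time $k$, and let $n_{\mathbf X}^k=\sum_i|\mathbf x_i^k|$, $n_{\mathbf Y}^k=\sum_j|\mathbf y_j^k|$. Let $\Pi_{\mathbf X,\mathbf Y}$ be the set of vectors $\pi\in\{0,\dots,n\}^m$ such that $\pi_i=\pi_{i'}>0$ implies $i=i'$. For $\pi\in\Pi_{\mathbf X,\mathbf Y}$ let $\theta^k(\pi)$ be the set of pairs $(i,\pi_i)$ with $\pi_i>0$, $|\mathbf x_i^k|=|\mathbf y_{\pi_i}^k|=1$ and $d_p^{(c,\rho)}(\mathbf x_i^k,\mathbf y_{\pi_i}^k)<c$. The T-GOSPA q-metric is $$d(\mathbf X,\mathbf Y)=\min_{\pi^1,\dots,\pi^T\in\Pi_{\mathbf X,\mathbf Y}}\Big(\sum_{k=1}^T\Big[\sum_{(i,j)\in\theta^k(\pi^k)}d_p^{(c,\rho)}(\mathbf x_i^k,\mathbf y_j^k)^p+\rho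 c^p\big(n_{\mathbf Y}^k-|\theta^k(\pi^k)|\big)+(1-\rho)c^p\big(n_{\mathbf X}^k-|\theta^k(\pi^k)|\big)\Big]+\gamma^p\sum_{k=1}^{T-1}\sum_{i=1}^m s(\pi_i^k,\pi_i^{k+1})\Big)^{1/p},$$ where $s(a,b)=0$ if $a=b$, $s(a,b)=1$ if $a\ne b$ are both nonzero, and $s(a,b)=\tfrac12$ otherwise. Let $(\Omega,\mathcal F,\mathbb P)$ be a probability space. A random finite set (RFS) of trajectories is a measurable map from $\Omega$ to the finite sets of trajectories, where the space of trajectories is the disjoint union over $(\omega,\nu)$ of the spaces $\mathbb X^\nu$, and a family of finite sets is measurable if for every $n$ the tuples $(X_1,\dots,X_n)$ of pairwise distinct trajectories with $\{X_1,\dots,X_n\}$ in the family form a measurable set of such tuples. RFSs that are almost surely equal are identified. Then, for every real $p'$ with $1\le p'<\infty$, on the space of RFSs of trajectories $\mathbf X$ on $(\Omega,\mathcal F,\mathbb P)$ with $\mathbb E\big[|\mathbf X|^{p'/p}\big]<\infty$, the expectation $\mathbb E\big[d(\mathbf X,\mathbf Y)^{p'}\big]$ is finite for all $\mathbf X,\mathbf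 Y$, and $$(\mathbf X,\mathbf Y)\mapsto\Big(\mathbb E\big[d(\mathbf X,\mathbf Y)^{p'}\big]\Big)^{1/p'}$$ is a q-metric. -/

import Mathlib

open MeasureTheory

noncomputable section

/-- A quasi-metric (q-metric): a non-negative real function satisfying the identity property and
the triangle inequality, not necessarily symmetric. -/
structure IsQMetric {S : Type*} (d : S → S → ℝ) : Prop where
  nonneg : ∀ x y, 0 ≤ d x y
  eq_zero_iff : ∀ x y, d x y = 0 ↔ x = y
  triangle : ∀ x y z, d x y ≤ d x z + d z y

/-- A trajectory in the time window `1, …, T`: a start time `ω` and a duration `ν` with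
`1 ≤ ω ≤ T` and `1 ≤ ν ≤ T - ω + 1`, and a sequence of `ν` states. It carries the σ-algebra
of the disjoint union over `(ω, ν)` of the product spaces `E ^ ν`. -/
abbrev Trajectory (T : ℕ) (E : Type*) : Type _ :=
  Σ s : {s : ℕ × ℕ // 1 ≤ s.1 ∧ s.1 ≤ T ∧ 1 ≤ s.2 ∧ s.1 + s.2 ≤ T + 1}, Fin s.1.2 → E

namespace Trajectory

variable {T : ℕ} {E : Type*}

/-- Start time step. -/
def start (X : Trajectory T E) : ℕ := X.1.1.1

/-- Duration. -/
def duration (X : Trajectory T E) : ℕ := X.1.1.2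

/-- The set of objects of the trajectory at time step `k`; it has at most one element and is
represented by an `Option` (`none` is the empty set, `some x` is `{x}`). -/
def stateAt (X : Trajectory T E) (k : ℕ) : Option E :=
  if h : X.start ≤ k ∧ k < X.start + X.duration then
    some (X.2 ⟨k - X.start, by have := h.1; have := h.2; unfold duration at *; omega⟩)
  else none

end Trajectory

/-- The GOSPA q-metric between sets of objects with at most one element. -/
def gospaOne {E : Type*} (db : E → E → ℝ) (c p ρ : ℝ) : Option E → Option E → ℝ
  | some x, some y => min c (db x y)
  | none, some _ => ρ ^ (1 / p) * c
  | some _, none => (1 - ρ) ^ (1 / p) * c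
  | none, none => 0

section TGOSPA

variable {T : ℕ} {E : Type*}

/-- Assignment vectors between the trajectories in `X` and those in `Y`. The vectors are indexed
by the elements of `X` themselves; the value `none` means unassigned, and no trajectory in `Y`
is assigned to two different trajectories in `X`. -/
def AssignmentVector (X Y : Finset (Trajectory T E)) : Type _ :=
  {π : X → Option Y // ∀ i i' : X, ∀ j : Y, π i = some j → π i' = some j → i = i'}

/-- The number of objects of `X` present at time step `k`. -/
def numPresent (X : Finset (Trajectory T E)) (k : ℕ) : ℕ :=
  ∑ i ∈ X, if (i.stateAt k).isSome then 1 else 0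

open Classical in
/-- The object-level assignment set at time step `k` determined by an assignment vector. -/
def objectAssignment (db : E → E → ℝ) (c p ρ : ℝ) (X Y : Finset (Trajectory T E)) (k : ℕ)
    (π : AssignmentVector X Y) : Finset (X × Y) :=
  Finset.univ.filter fun ij : X × Y =>
    π.1 ij.1 = some ij.2 ∧ (ij.1.1.stateAt k).isSome ∧ (ij.2.1.stateAt k).isSome ∧
      gospaOne db c p ρ (ij.1.1.stateAt k) (ij.2.1.stateAt k) < c

/-- Localisation, false-object and missed-object costs (to the `p`-th power) at time step `k`. -/
def stepCost (db : E → E → ℝ) (c p ρ : ℝ) (X Y : Finset (Trajectory T E)) (k : ℕ)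
    (π : AssignmentVector X Y) : ℝ :=
  (∑ ij ∈ objectAssignment db c p ρ X Y k π,
      gospaOne db c p ρ (ij.1.1.stateAt k) (ij.2.1.stateAt k) ^ p)
    + ρ * c ^ p * ((numPresent Y k : ℝ) - ((objectAssignment db c p ρ X Y k π).card : ℝ))
    + (1 - ρ) * c ^ p * ((numPresent X k : ℝ) - ((objectAssignment db c p ρ X Y k π).card : ℝ))

open Classical in
/-- The number of track switches (a half-switch counts `1 / 2`) contributed by one entry of two
consecutive assignment vectors. -/
def switchCount {α : Type*} (a b : Option α) : ℝ :=
  if a = b then 0 else if a ≠ none ∧ b ≠ none then 1 else 1 / 2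

/-- The track switch penalty (to the `p`-th power) between two consecutive time steps. -/
def switchCost (γ p : ℝ) {X Y : Finset (Trajectory T E)} (π π' : AssignmentVector X Y) : ℝ :=
  γ ^ p * ∑ i : X, switchCount (π.1 i) (π'.1 i)

/-- The cost of a sequence of assignment vectors (to the `p`-th power). The index `k : Fin T`
stands for the time step `k + 1`, so that time runs over `1, …, T`. -/
def sequenceCost (db : E → E → ℝ) (c p γ ρ : ℝ) (X Y : Finset (Trajectory T E))
    (π : Fin T → AssignmentVector X Y) : ℝ :=
  (∑ k : Fin T, stepCost db c p ρ X Y ((k : ℕ) + 1) (π k))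
    + ∑ k : Fin (T - 1),
        switchCost γ p (π ⟨(k : ℕ), by omega⟩) (π ⟨(k : ℕ) + 1, by omega⟩)

/-- The T-GOSPA q-metric between two finite sets of trajectories. The infimum is over a finite
nonempty set of sequences of assignment vectors, hence is a minimum. -/
def tgospa (db : E → E → ℝ) (c p γ ρ : ℝ) (X Y : Finset (Trajectory T E)) : ℝ :=
  ⨅ π : Fin T → AssignmentVector X Y, sequenceCost db c p γ ρ X Y π ^ (1 / p)

instance (X Y : Finset (Trajectory T E)) : Finite (AssignmentVector X Y) :=
  Subtype.finite

instance (X Y : Finset (Trajectory T E)) : Nonempty (AssignmentVector X Y) :=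
  ⟨⟨fun _ => none, fun _ _ _ h => by simp at h⟩⟩

end TGOSPA

/-- The σ-algebra on the finite subsets of a measurable space `F`: a family of finite sets is
measurable if, for every `n`, the family of the tuples `(x₁, …, xₙ)` of pairwise distinct points
with `{x₁, …, xₙ}` in it is measurable in the space of such tuples. It makes every counting map
`s ↦ |s ∩ B|`, with `B` measurable, measurable. (The instance on `Finset` in Mathlib is generated
by the events `a ∈ s` alone, which is too coarse for uncountable `F`.) -/
abbrev finiteSetSigma (F : Type*) [MeasurableSpace F] : MeasurableSpace (Finset F) :=
  ⨅ n : ℕ, MeasurableSpace.map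
    (fun x : {x : Fin n → F // Function.Injective x} => Finset.univ.map ⟨x.1, x.2⟩)
    inferInstance

section RFS

variable {Ω : Type*} [MeasurableSpace Ω] (P : Measure Ω) (T : ℕ) (E : Type*) [MeasurableSpace E]

/-- Random finite sets of trajectories on the probability space `(Ω, P)` with finite cardinality
moment of order `r`. -/
structure TrajectoryRFS (r : ℝ) where
  toFun : Ω → Finset (Trajectory T E)
  measurable : Measurable[_, finiteSetSigma (Trajectory T E)] toFun
  moment : Integrable (fun ω => ((toFun ω).card : ℝ) ^ r) P

/-- As usual for random variables, almost surely equal random finite sets are identified. -/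
instance TrajectoryRFS.setoid (r : ℝ) : Setoid (TrajectoryRFS P T E r) where
  r X Y := X.toFun =ᵐ[P] Y.toFun
  iseqv := ⟨fun _ => Filter.EventuallyEq.rfl, fun h => h.symm, fun h h' => h.trans h'⟩

/-- The space of random finite sets of trajectories with finite cardinality moment of order `r`,
modulo almost sure equality. -/
def RFSSpace (r : ℝ) : Type _ := Quotient (TrajectoryRFS.setoid P T E r)

variable {P T E}

/-- `(E[d(X, Y)^p'])^(1/p')` for random finite sets `X`, `Y`, with `d` the T-GOSPA q-metric. -/
def rfsDist (db : E → E → ℝ) (c p γ ρ p' : ℝ) {r : ℝ} (X Y : TrajectoryRFS P T E r) : ℝ :=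
  (∫ ω, tgospa db c p γ ρ (X.toFun ω) (Y.toFun ω) ^ p' ∂P) ^ (1 / p')

/-- `rfsDist` on the space of random finite sets modulo almost sure equality. -/
def rfsQDist (db : E → E → ℝ) (c p γ ρ p' : ℝ) {r : ℝ} : RFSSpace P T E r → RFSSpace P T E r → ℝ :=
  Quotient.lift₂ (rfsDist db c p γ ρ p') fun X Y X' Y' (hX : X.toFun =ᵐ[P] X'.toFun)
      (hY : Y.toFun =ᵐ[P] Y'.toFun) => by
    unfold rfsDist
    congr 1
    refine integral_congr_ae ?_
    filter_upwards [hX, hY] with ω h h'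
    rw [h, h']

end RFS

end

/-! Give every unmatched trajectory a dummy partner, whose set of objects is always empty. Then the
cost of a partial matching is a sum over its edges of `p`-th powers of `gospaOne`, which is a
q-metric on sets with at most one element. When two matchings are composed through a third family
`ζ`, each of the three costs is a sum over `ζ`, by counting edges from the left or from the right,
plus the same dummy edges on the outer sides; Minkowski's inequality over `ζ` then gives the
triangle inequality at each time. Track switches are subadditive under composition, and
`x ↦ x ^ (1 / p)` is subadditive, so Minkowski over time and over the two kinds of costs gives the
triangle inequality of T-GOSPA. If the distance vanishes, the optimal matching is constant in time
and identifies trajectories with the same states.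

T-GOSPA is at most a constant times `|X| ^ (1 / p) + |Y| ^ (1 / p)`, hence in `L^p'`, and Minkowski
in `L^p'` finishes. For measurability no enumeration of a random finite set has to be selected: the
counting measure on all its enumerations is a finite kernel, and the enumerations with a measurable
property have positive mass exactly when the set has it.
-/

noncomputable section

section Minkowski

variable {L : Type*} {p : ℝ}

lemma rpow_sum_le_rpow_sum_add {s : Finset L} {x y z : L → ℝ} (hp : 1 ≤ p)
    (hx : ∀ l ∈ s, 0 ≤ x l) (hy : ∀ l ∈ s, 0 ≤ y l) (hz : ∀ l ∈ s, 0 ≤ z l)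
    (h : ∀ l ∈ s, z l ^ (1 / p) ≤ x l ^ (1 / p) + y l ^ (1 / p)) :
    (∑ l ∈ s, z l) ^ (1 / p) ≤ (∑ l ∈ s, x l) ^ (1 / p) + (∑ l ∈ s, y l) ^ (1 / p) := by
  have hp0 : 0 < p := by linarith
  have hpow {w : L → ℝ} (hw : ∀ l ∈ s, 0 ≤ w l) :
      ∑ l ∈ s, w l = ∑ l ∈ s, (w l ^ (1 / p)) ^ p :=
    Finset.sum_congr rfl fun l hl => by
      rw [one_div, Real.rpow_inv_rpow (hw l hl) hp0.ne']
  rw [hpow hx, hpow hy]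
  refine le_trans (Real.rpow_le_rpow (Finset.sum_nonneg hz) ?_ (by positivity))
    (Real.Lp_add_le_of_nonneg s hp (fun l hl => Real.rpow_nonneg (hx l hl) _)
      fun l hl => Real.rpow_nonneg (hy l hl) _)
  rw [hpow hz]
  gcongr with l hl
  · exact Real.rpow_nonneg (hz l hl) _
  · exact h l hl

lemma rpow_add_le_rpow_add_add {x₁ x₂ y₁ y₂ z₁ z₂ : ℝ} (hp : 1 ≤ p) (hx₁ : 0 ≤ x₁)
    (hx₂ : 0 ≤ x₂) (hy₁ : 0 ≤ y₁) (hy₂ : 0 ≤ y₂) (hz₁ : 0 ≤ z₁) (hz₂ : 0 ≤ z₂)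
    (h₁ : z₁ ^ (1 / p) ≤ x₁ ^ (1 / p) + y₁ ^ (1 / p))
    (h₂ : z₂ ^ (1 / p) ≤ x₂ ^ (1 / p) + y₂ ^ (1 / p)) :
    (z₁ + z₂) ^ (1 / p) ≤ (x₁ + x₂) ^ (1 / p) + (y₁ + y₂) ^ (1 / p) := by
  simpa [Fin.sum_univ_two] using
    rpow_sum_le_rpow_sum_add (s := Finset.univ) (x := ![x₁, x₂]) (y := ![y₁, y₂]) (z := ![z₁, z₂])
      hp (by simp [Fin.forall_fin_two, *]) (by simp [Fin.forall_fin_two, *])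
      (by simp [Fin.forall_fin_two, *]) (by simp [Fin.forall_fin_two, -one_div, *])

end Minkowski

section EdgeSum

variable {ι ζ κ M : Type*} [Fintype ι] [Fintype ζ] [Fintype κ] [AddCommMonoid M]

instance [Finite ι] [Finite κ] : Finite (ι ≃. κ) := DFunLike.finite _

/-- The sum of the weights `φ` over the edges of the partial matching `f`, where `none` stands for
a dummy partner: an unmatched `i` is an edge `(some i, none)` and an unmatched `j` is an edge
`(none, some j)`. -/
def edgeSum (φ : Option ι → Option κ → M) (f : ι ≃. κ) : M :=
  ∑ i, φ (some i) (f i) + ∑ j, (f.symm j).elim (φ none (some j)) fun _ => 0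

open Classical in
lemma eq_elim_add_sum_ite (ψ : Option κ → M) (o : Option κ) :
    ψ o = o.elim (ψ none) (fun _ => 0) + ∑ j, if o = some j then ψ (some j) else 0 := by
  cases o <;> simp

lemma edgeSum_eq_right (φ : Option ι → Option κ → M) (f : ι ≃. κ) :
    edgeSum φ f
      = ∑ i, (f i).elim (φ (some i) none) (fun _ => 0) + ∑ j, φ (f.symm j) (some j) := by
  classical
  have hleft : ∑ i, φ (some i) (f i) = ∑ i, (f i).elim (φ (some i) none) (fun _ => 0)
      + ∑ i, ∑ j, if f i = some j then φ (some i) (some j) else 0 := by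
    rw [← Finset.sum_add_distrib]
    exact Finset.sum_congr rfl fun i _ => eq_elim_add_sum_ite (φ (some i)) (f i)
  have hright : ∑ j, φ (f.symm j) (some j)
      = ∑ j, (f.symm j).elim (φ none (some j)) (fun _ => 0)
        + ∑ j, ∑ i, if f i = some j then φ (some i) (some j) else 0 := by
    rw [← Finset.sum_add_distrib]
    refine Finset.sum_congr rfl fun j _ => ?_
    simpa only [f.eq_some_iff] using eq_elim_add_sum_ite (φ · (some j)) (f.symm j)
  rw [edgeSum, hleft, hright, Finset.sum_comm, add_assoc, add_comm (∑ j, ∑ i, _)]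

-- Both instances of `edgeSum_eq_right` contain the edges `(none, g z)` with `z` unmatched by `f`,
-- on opposite sides.
lemma edgeSum_trans {φ : Option ι → Option κ → M} (hφ : φ none none = 0) (f : ι ≃. ζ)
    (g : ζ ≃. κ) :
    edgeSum φ (f.trans g) = ∑ i, (f i).elim (φ (some i) none) (fun _ => 0)
      + ∑ z, φ (f.symm z) (g z) + ∑ j, (g.symm j).elim (φ none (some j)) (fun _ => 0) := by
  have hf := edgeSum_eq_right (fun x z => φ x (z.bind g)) f
  have hg := edgeSum_eq_right
    (fun (z : Option ζ) y => (z.bind f.symm).elim (φ none y) fun _ => 0) g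
  have hzero (z : ζ) : (g z).elim ((f.symm z).elim (φ none none) fun _ => 0) (fun _ => 0) = 0 := by
    cases g z <;> cases f.symm z <;> simp [hφ]
  simp only [edgeSum, Option.bind_some, Option.bind_none, Option.elim_none, hzero,
    Finset.sum_const_zero, zero_add] at hf hg
  rw [← hf, add_assoc, hg]
  rfl

lemma edgeSum_left (φ : Option ι → M) (hφ : φ none = 0) (f : ι ≃. κ) :
    edgeSum (fun x _ => φ x) f = ∑ i, φ (some i) := by
  have hdummy (j : κ) : (f.symm j).elim (φ none) (fun _ => 0) = 0 := by cases f.symm j <;> simp [hφ]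
  simp [edgeSum, hdummy]

lemma edgeSum_right (ψ : Option κ → M) (hψ : ψ none = 0) (f : ι ≃. κ) :
    edgeSum (fun _ y => ψ y) f = ∑ j, ψ (some j) := by
  have hdummy (i : ι) : (f i).elim (ψ none) (fun _ => 0) = 0 := by cases f i <;> simp [hψ]
  simp [edgeSum_eq_right, hdummy]

lemma sum_elim_le_sum (f : ι ≃. κ) {h : κ → ℝ} (hh : ∀ j, 0 ≤ h j) :
    ∑ i, (f i).elim 0 h ≤ ∑ j, h j := by
  refine le_of_le_of_eq ?_ (edgeSum_right (fun y => y.elim 0 h) rfl f)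
  exact le_add_of_nonneg_right (Finset.sum_nonneg fun j _ => by cases f.symm j <;> simp [hh])

lemma edgeSum_add (φ ψ : Option ι → Option κ → M) (f : ι ≃. κ) :
    edgeSum (fun x y => φ x y + ψ x y) f = edgeSum φ f + edgeSum ψ f := by
  have hdummy (j : κ) : (f.symm j).elim (φ none (some j) + ψ none (some j)) (fun _ => 0)
      = (f.symm j).elim (φ none (some j)) (fun _ => 0)
        + (f.symm j).elim (ψ none (some j)) (fun _ => 0) := by
    cases f.symm j <;> simp
  simp only [edgeSum, hdummy, Finset.sum_add_distrib]
  exact add_add_add_comm ..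

end EdgeSum

section Switching

variable {ι ζ κ : Type*} {T : ℕ}

lemma switchCount_nonneg (a b : Option ι) : 0 ≤ switchCount a b := by
  unfold switchCount
  split_ifs <;> norm_num

@[simp]
lemma switchCount_self (a : Option ι) : switchCount a a = 0 := by
  simp [switchCount]

lemma switchCount_eq_zero_iff {a b : Option ι} : switchCount a b = 0 ↔ a = b := by
  unfold switchCount
  split_ifs <;> simp_all

lemma switchCount_bind_le (a a' : Option ζ) (g g' : ζ → Option κ) :
    switchCount (a.bind g) (a'.bind g')
      ≤ switchCount a a' + a.elim 0 fun z => switchCount (g z) (g' z) := by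
  by_cases h : a = a'
  · subst h
    cases a <;> simp
  have hbind : switchCount (a.bind g) (a'.bind g') ≤ switchCount a a' := by
    rcases a with _ | z <;> rcases a' with _ | z' <;>
      simp only [switchCount, Option.bind_none] <;> split_ifs <;> (simp_all; try norm_num)
  refine le_add_of_le_of_nonneg hbind ?_
  cases a <;> simp [switchCount_nonneg]

variable [Fintype ι] [Fintype ζ]

/-- The number of track switches along a sequence of partial matchings. -/
def numSwitches (f : Fin T → (ι ≃. κ)) : ℝ :=
  ∑ k : Fin (T - 1),
    ∑ i, switchCount (f ⟨(k : ℕ), by omega⟩ i) (f ⟨(k : ℕ) + 1, by omega⟩ i)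

lemma numSwitches_nonneg (f : Fin T → (ι ≃. κ)) : 0 ≤ numSwitches f :=
  Finset.sum_nonneg fun _ _ => Finset.sum_nonneg fun _ _ => switchCount_nonneg _ _

@[simp]
lemma numSwitches_const (g : ι ≃. κ) : numSwitches (fun _ : Fin T => g) = 0 := by
  simp [numSwitches]

lemma numSwitches_trans_le (f : Fin T → (ι ≃. ζ)) (g : Fin T → (ζ ≃. κ)) :
    numSwitches (fun k => (f k).trans (g k)) ≤ numSwitches f + numSwitches g := by
  simp only [numSwitches, ← Finset.sum_add_distrib (s := (Finset.univ : Finset (Fin (T - 1))))]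
  refine Finset.sum_le_sum fun k _ =>
    (Finset.sum_le_sum fun i _ => switchCount_bind_le _ _ _ _).trans ?_
  rw [Finset.sum_add_distrib]
  gcongr
  exact sum_elim_le_sum _ fun _ => switchCount_nonneg _ _

lemma eq_const_of_numSwitches_eq_zero {f : Fin T → (ι ≃. κ)} (h : numSwitches f = 0) :
    ∃ g, f = fun _ => g := by
  cases T with
  | zero => exact ⟨⊥, Subsingleton.elim _ _⟩
  | succ n =>
    refine ⟨f 0, funext fun k => ?_⟩
    have hnonneg (k : Fin n) :
        0 ≤ ∑ i, switchCount (f ⟨k, by omega⟩ i) (f ⟨k + 1, by omega⟩ i) :=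
      Finset.sum_nonneg fun _ _ => switchCount_nonneg _ _
    induction k using Fin.induction with
    | zero => rfl
    | succ k ih =>
      rw [← ih]
      ext1 i
      have hk := (Finset.sum_eq_zero_iff_of_nonneg fun k _ => hnonneg k).1 h k (Finset.mem_univ _)
      have hi := (Finset.sum_eq_zero_iff_of_nonneg
        fun _ _ => switchCount_nonneg _ _).1 hk i (Finset.mem_univ _)
      exact (switchCount_eq_zero_iff.1 hi).symm

end Switching

section TrackDist

variable {S ι ι' ζ κ κ' : Type*} {T : ℕ} [Fintype ι] [Fintype ι'] [Fintype ζ] [Fintype κ]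
  [Fintype κ'] {d : S → S → ℝ} {o : S} {p γ : ℝ}

/-- The cost (to the `p`-th power) of the partial matching `f` between two finite families of
points of `S`, where an unmatched point pays its distance to the base point `o`, with the
orientation of `d` kept. -/
def matchingCost (d : S → S → ℝ) (o : S) (p : ℝ) (a : ι → S) (b : κ → S) (f : ι ≃. κ) : ℝ :=
  edgeSum (fun x y => d (x.elim o a) (y.elim o b) ^ p) f

/-- The cost (to the `p`-th power) of a sequence of partial matchings between two finite families
of tracks `Fin T → S`: the matching costs at each time plus `γ ^ p` per track switch. -/
def trackCost (d : S → S → ℝ) (o : S) (p γ : ℝ) (a : Fin T → ι → S) (b : Fin T → κ → S)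
    (f : Fin T → (ι ≃. κ)) : ℝ :=
  ∑ k, matchingCost d o p (a k) (b k) (f k) + γ ^ p * numSwitches f

/-- The least cost of matching two finite families of tracks in a pointed q-metric space. The
T-GOSPA q-metric is the case where `S` is the space of sets with at most one element, with base
point `∅`; see `tgospa_eq_trackDist`. -/
def trackDist (d : S → S → ℝ) (o : S) (p γ : ℝ) (a : Fin T → ι → S) (b : Fin T → κ → S) : ℝ :=
  ⨅ f : Fin T → (ι ≃. κ), trackCost d o p γ a b f ^ (1 / p)

lemma matchingCost_nonneg (hd : ∀ x y, 0 ≤ d x y) (a : ι → S) (b : κ → S) (f : ι ≃. κ) :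
    0 ≤ matchingCost d o p a b f := by
  refine add_nonneg (Finset.sum_nonneg fun i _ => Real.rpow_nonneg (hd _ _) _)
    (Finset.sum_nonneg fun j _ => ?_)
  cases f.symm j <;> simp [Real.rpow_nonneg, hd]

lemma sum_matchingCost_nonneg (hd : ∀ x y, 0 ≤ d x y) (a : Fin T → ι → S) (b : Fin T → κ → S)
    (f : Fin T → (ι ≃. κ)) : 0 ≤ ∑ k, matchingCost d o p (a k) (b k) (f k) :=
  Finset.sum_nonneg fun _ _ => matchingCost_nonneg hd _ _ _

lemma trackCost_nonneg (hd : ∀ x y, 0 ≤ d x y) (hγ : 0 ≤ γ) (a : Fin T → ι → S)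
    (b : Fin T → κ → S) (f : Fin T → (ι ≃. κ)) : 0 ≤ trackCost d o p γ a b f :=
  add_nonneg (sum_matchingCost_nonneg hd a b f)
    (mul_nonneg (Real.rpow_nonneg hγ _) (numSwitches_nonneg f))

lemma trackDist_nonneg (hd : ∀ x y, 0 ≤ d x y) (hγ : 0 ≤ γ) (a : Fin T → ι → S)
    (b : Fin T → κ → S) : 0 ≤ trackDist d o p γ a b :=
  Real.iInf_nonneg fun f => Real.rpow_nonneg (trackCost_nonneg hd hγ a b f) _

lemma trackDist_le (a : Fin T → ι → S) (b : Fin T → κ → S) (f : Fin T → (ι ≃. κ)) :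
    trackDist d o p γ a b ≤ trackCost d o p γ a b f ^ (1 / p) :=
  ciInf_le (Set.finite_range _).bddBelow f

lemma exists_trackDist_eq (a : Fin T → ι → S) (b : Fin T → κ → S) :
    ∃ f, trackDist d o p γ a b = trackCost d o p γ a b f ^ (1 / p) :=
  let ⟨f, hf⟩ := exists_eq_ciInf_of_finite (f := fun f => trackCost d o p γ a b f ^ (1 / p))
  ⟨f, hf.symm⟩

lemma sum_rpow_triangle (hd : IsQMetric d) (hp : 1 ≤ p) (x y w : ζ → S) :
    (∑ z, d (x z) (y z) ^ p) ^ (1 / p)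
      ≤ (∑ z, d (x z) (w z) ^ p) ^ (1 / p) + (∑ z, d (w z) (y z) ^ p) ^ (1 / p) := by
  have hpow (u v : S) : 0 ≤ d u v ^ p := Real.rpow_nonneg (hd.nonneg u v) p
  refine rpow_sum_le_rpow_sum_add hp (fun _ _ => hpow _ _) (fun _ _ => hpow _ _)
    (fun _ _ => hpow _ _) fun z _ => ?_
  simp only [one_div, Real.rpow_rpow_inv (hd.nonneg _ _) (by linarith : p ≠ 0)]
  exact hd.triangle _ _ _

lemma matchingCost_trans_le (hd : IsQMetric d) (hp : 1 ≤ p) (a : ι → S) (e : ζ → S) (b : κ → S)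
    (f : ι ≃. ζ) (g : ζ ≃. κ) :
    matchingCost d o p a b (f.trans g) ^ (1 / p)
      ≤ matchingCost d o p a e f ^ (1 / p) + matchingCost d o p e b g ^ (1 / p) := by
  have hoo : d o o ^ p = 0 := by
    rw [(hd.eq_zero_iff o o).2 rfl, Real.zero_rpow (by linarith)]
  have hpow (x y : S) : 0 ≤ d x y ^ p := Real.rpow_nonneg (hd.nonneg x y) p
  set unmatchedLeft := ∑ i, (f i).elim (d (a i) o ^ p) fun _ => 0
  set unmatchedRight := ∑ j, (g.symm j).elim (d o (b j) ^ p) fun _ => 0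
  have hleft : 0 ≤ unmatchedLeft :=
    Finset.sum_nonneg fun i _ => by cases f i <;> simp [hpow]
  have hright : 0 ≤ unmatchedRight :=
    Finset.sum_nonneg fun j _ => by cases g.symm j <;> simp [hpow]
  have hf : matchingCost d o p a e f
      = unmatchedLeft + ∑ z, d ((f.symm z).elim o a) (e z) ^ p + 0 := by
    rw [add_zero]
    exact edgeSum_eq_right _ f
  have hg : matchingCost d o p e b g
      = 0 + ∑ z, d (e z) ((g z).elim o b) ^ p + unmatchedRight := by
    rw [zero_add]
    rfl
  have hfg : matchingCost d o p a b (f.trans g)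
      = unmatchedLeft + ∑ z, d ((f.symm z).elim o a) ((g z).elim o b) ^ p + unmatchedRight :=
    edgeSum_trans hoo f g
  have hsum {φ : ζ → ℝ} (hφ : ∀ z, 0 ≤ φ z) : 0 ≤ ∑ z, φ z := Finset.sum_nonneg fun z _ => hφ z
  have hzero : (0 : ℝ) ≤ 0 ^ (1 / p) := Real.rpow_nonneg le_rfl _
  rw [hf, hg, hfg]
  refine rpow_add_le_rpow_add_add hp ?_ le_rfl ?_ hright ?_ hright
    (rpow_add_le_rpow_add_add hp hleft ?_ le_rfl ?_ hleft ?_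
      (le_add_of_nonneg_right hzero) (sum_rpow_triangle hd hp _ _ _)) (le_add_of_nonneg_left hzero)
  all_goals
    first
      | exact hsum fun _ => hpow _ _
      | exact add_nonneg hleft (hsum fun _ => hpow _ _)
      | exact add_nonneg le_rfl (hsum fun _ => hpow _ _)

lemma trackCost_trans_le (hd : IsQMetric d) (hp : 1 ≤ p) (hγ : 0 ≤ γ) (a : Fin T → ι → S)
    (e : Fin T → ζ → S) (b : Fin T → κ → S) (f : Fin T → (ι ≃. ζ)) (g : Fin T → (ζ ≃. κ)) :
    trackCost d o p γ a b (fun k => (f k).trans (g k)) ^ (1 / p)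
      ≤ trackCost d o p γ a e f ^ (1 / p) + trackCost d o p γ e b g ^ (1 / p) := by
  have hγp : 0 ≤ γ ^ p := Real.rpow_nonneg hγ p
  have hswitch : (γ ^ p * numSwitches fun k => (f k).trans (g k)) ^ (1 / p)
      ≤ (γ ^ p * numSwitches f) ^ (1 / p) + (γ ^ p * numSwitches g) ^ (1 / p) :=
    calc (γ ^ p * numSwitches fun k => (f k).trans (g k)) ^ (1 / p)
        ≤ (γ ^ p * numSwitches f + γ ^ p * numSwitches g) ^ (1 / p) := by
          rw [← mul_add]
          exact Real.rpow_le_rpow (mul_nonneg hγp (numSwitches_nonneg _))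
            (mul_le_mul_of_nonneg_left (numSwitches_trans_le f g) hγp) (by positivity)
      _ ≤ _ := Real.rpow_add_le_add_rpow (mul_nonneg hγp (numSwitches_nonneg f))
          (mul_nonneg hγp (numSwitches_nonneg g)) (by positivity)
          (by rw [one_div]; exact inv_le_one_of_one_le₀ hp)
  have hmatch : (∑ k, matchingCost d o p (a k) (b k) ((f k).trans (g k))) ^ (1 / p)
      ≤ (∑ k, matchingCost d o p (a k) (e k) (f k)) ^ (1 / p)
        + (∑ k, matchingCost d o p (e k) (b k) (g k)) ^ (1 / p) := by
    refine rpow_sum_le_rpow_sum_add hp ?_ ?_ ?_ fun k _ => matchingCost_trans_le hd hp _ _ _ _ _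
    all_goals exact fun k _ => matchingCost_nonneg hd.nonneg _ _ _
  exact rpow_add_le_rpow_add_add hp (sum_matchingCost_nonneg hd.nonneg a e f)
    (mul_nonneg hγp (numSwitches_nonneg f)) (sum_matchingCost_nonneg hd.nonneg e b g)
    (mul_nonneg hγp (numSwitches_nonneg g)) (sum_matchingCost_nonneg hd.nonneg a b _)
    (mul_nonneg hγp (numSwitches_nonneg _)) hmatch hswitch

lemma trackDist_triangle (hd : IsQMetric d) (hp : 1 ≤ p) (hγ : 0 ≤ γ) (a : Fin T → ι → S)
    (e : Fin T → ζ → S) (b : Fin T → κ → S) :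
    trackDist d o p γ a b ≤ trackDist d o p γ a e + trackDist d o p γ e b := by
  obtain ⟨f, hf⟩ := exists_trackDist_eq (d := d) (o := o) (p := p) (γ := γ) a e
  obtain ⟨g, hg⟩ := exists_trackDist_eq (d := d) (o := o) (p := p) (γ := γ) e b
  rw [hf, hg]
  exact (trackDist_le a b _).trans (trackCost_trans_le hd hp hγ a e b f g)

lemma trackDist_comp_equiv_self (hd : IsQMetric d) (hp : p ≠ 0) (hγ : 0 ≤ γ)
    (a : Fin T → ι → S) (e : ι' ≃ ι) : trackDist d o p γ (fun k => a k ∘ e) a = 0 := by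
  have hself (x : S) : d x x = 0 := (hd.eq_zero_iff x x).2 rfl
  have hcost : trackCost d o p γ (fun k => a k ∘ e) a (fun _ => e.toPEquiv) = 0 := by
    simp [trackCost, matchingCost, edgeSum, ← Equiv.toPEquiv_symm, Equiv.toPEquiv_apply, hself,
      Real.zero_rpow hp]
  refine le_antisymm ((trackDist_le _ _ fun _ => e.toPEquiv).trans ?_)
    (trackDist_nonneg hd.nonneg hγ _ _)
  rw [hcost, Real.zero_rpow (one_div_ne_zero hp)]

lemma trackDist_self_comp_equiv (hd : IsQMetric d) (hp : p ≠ 0) (hγ : 0 ≤ γ)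
    (a : Fin T → ι → S) (e : ι' ≃ ι) : trackDist d o p γ a (fun k => a k ∘ e) = 0 := by
  simpa [Function.comp_assoc] using
    trackDist_comp_equiv_self (o := o) hd hp hγ (fun k => a k ∘ e) e.symm

lemma trackDist_comp_equiv (hd : IsQMetric d) (hp : 1 ≤ p) (hγ : 0 ≤ γ) (a : Fin T → ι → S)
    (b : Fin T → κ → S) (e : ι' ≃ ι) (e' : κ' ≃ κ) :
    trackDist d o p γ (fun k => a k ∘ e) (fun k => b k ∘ e') = trackDist d o p γ a b := by
  have hp0 : p ≠ 0 := by linarith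
  apply le_antisymm
  · calc _ ≤ _ := trackDist_triangle hd hp hγ _ a _
      _ ≤ _ := add_le_add_right (trackDist_triangle hd hp hγ a b _) _
      _ = trackDist d o p γ a b := by
        rw [trackDist_comp_equiv_self hd hp0 hγ, trackDist_self_comp_equiv hd hp0 hγ, zero_add,
          add_zero]
  · calc _ ≤ _ := trackDist_triangle hd hp hγ a (fun k => a k ∘ e) b
      _ ≤ _ := add_le_add_right (trackDist_triangle hd hp hγ _ (fun k => b k ∘ e') b) _
      _ = trackDist d o p γ (fun k => a k ∘ e) (fun k => b k ∘ e') := by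
        rw [trackDist_comp_equiv_self hd hp0 hγ, trackDist_self_comp_equiv hd hp0 hγ, zero_add,
          add_zero]

lemma matchingCost_eq_zero (hd : IsQMetric d) (hp : p ≠ 0) {a : ι → S} {b : κ → S} {f : ι ≃. κ}
    (h : matchingCost d o p a b f = 0) :
    (∀ i, a i = (f i).elim o b) ∧ ∀ j, b j = (f.symm j).elim o a := by
  have hpow (x y : S) : 0 ≤ d x y ^ p := Real.rpow_nonneg (hd.nonneg x y) p
  have heq {x y : S} (hxy : d x y ^ p = 0) : x = y :=
    (hd.eq_zero_iff x y).1 ((Real.rpow_eq_zero (hd.nonneg x y) hp).1 hxy)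
  have hleft : 0 ≤ ∑ i, (f i).elim (d (a i) o ^ p) fun _ => 0 :=
    Finset.sum_nonneg fun i _ => by cases f i <;> simp [hpow]
  have hright : 0 ≤ ∑ j, (f.symm j).elim (d o (b j) ^ p) fun _ => 0 :=
    Finset.sum_nonneg fun j _ => by cases f.symm j <;> simp [hpow]
  constructor
  · have hsum : ∑ i, d (a i) ((f i).elim o b) ^ p = 0 :=
      ((add_eq_zero_iff_of_nonneg (Finset.sum_nonneg fun _ _ => hpow _ _) hright).1 h).1
    exact fun i => heq ((Finset.sum_eq_zero_iff_of_nonneg fun _ _ => hpow _ _).1 hsum i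
      (Finset.mem_univ i))
  · rw [matchingCost, edgeSum_eq_right] at h
    have hsum : ∑ j, d ((f.symm j).elim o a) (b j) ^ p = 0 :=
      ((add_eq_zero_iff_of_nonneg hleft (Finset.sum_nonneg fun _ _ => hpow _ _)).1 h).2
    exact fun j => (heq ((Finset.sum_eq_zero_iff_of_nonneg fun _ _ => hpow _ _).1 hsum j
      (Finset.mem_univ j))).symm

lemma exists_matching_of_trackDist_eq_zero (hd : IsQMetric d) (hp : p ≠ 0) (hγ : 0 < γ)
    {a : Fin T → ι → S} {b : Fin T → κ → S} (h : trackDist d o p γ a b = 0) :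
    ∃ f : ι ≃. κ, ∀ k,
      (∀ i, a k i = (f i).elim o (b k)) ∧ ∀ j, b k j = (f.symm j).elim o (a k) := by
  obtain ⟨f, hf⟩ := exists_trackDist_eq (d := d) (o := o) (p := p) (γ := γ) a b
  rw [h, eq_comm, Real.rpow_eq_zero (trackCost_nonneg hd.nonneg hγ.le a b f)
    (one_div_ne_zero hp)] at hf
  have hγp : 0 < γ ^ p := Real.rpow_pos_of_pos hγ p
  obtain ⟨hcost, hswitch⟩ := (add_eq_zero_iff_of_nonneg
    (sum_matchingCost_nonneg hd.nonneg a b f) (mul_nonneg hγp.le (numSwitches_nonneg f))).1 hf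
  obtain ⟨g, rfl⟩ := eq_const_of_numSwitches_eq_zero
    ((mul_eq_zero.1 hswitch).resolve_left hγp.ne')
  exact ⟨g, fun k => matchingCost_eq_zero hd hp
    ((Finset.sum_eq_zero_iff_of_nonneg fun _ _ => matchingCost_nonneg hd.nonneg _ _ _).1 hcost k
      (Finset.mem_univ k))⟩

lemma trackDist_le_of_le (hd : ∀ x y, 0 ≤ d x y) (hp : 0 ≤ p) {C : ℝ} (hleft : ∀ x, d x o ≤ C)
    (hright : ∀ x, d o x ≤ C) (a : Fin T → ι → S) (b : Fin T → κ → S) :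
    trackDist d o p γ a b ≤ (T * C ^ p * (Fintype.card ι + Fintype.card κ)) ^ (1 / p) := by
  have hcost (k : Fin T) : matchingCost d o p (a k) (b k) ⊥
      ≤ C ^ p * (Fintype.card ι + Fintype.card κ) := by
    have hl : ∑ i, d (a k i) o ^ p ≤ Fintype.card ι • C ^ p :=
      Finset.sum_le_card_nsmul _ _ _ fun i _ => Real.rpow_le_rpow (hd _ _) (hleft _) hp
    have hr : ∑ j, d o (b k j) ^ p ≤ Fintype.card κ • C ^ p :=
      Finset.sum_le_card_nsmul _ _ _ fun j _ => Real.rpow_le_rpow (hd _ _) (hright _) hp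
    rw [nsmul_eq_mul] at hl hr
    simp only [matchingCost, edgeSum, PEquiv.bot_apply, PEquiv.symm_bot, Option.elim_none,
      Option.elim_some]
    linarith
  refine (trackDist_le a b fun _ => ⊥).trans
    (Real.rpow_le_rpow (add_nonneg (sum_matchingCost_nonneg hd a b _) (by simp)) ?_ (by positivity))
  have hsum := Finset.sum_le_card_nsmul Finset.univ _ _ fun k _ => hcost k
  rwa [Finset.card_univ, Fintype.card_fin, nsmul_eq_mul, ← mul_assoc, ← add_zero (∑ k, _),
    ← mul_zero (γ ^ p), ← numSwitches_const (T := T) (⊥ : ι ≃. κ)] at hsum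

lemma measurable_trackDist [MeasurableSpace S] {Ω : Type*} [MeasurableSpace Ω]
    (hd : Measurable (Function.uncurry d)) {a : Ω → Fin T → ι → S} {b : Ω → Fin T → κ → S}
    (ha : ∀ k i, Measurable fun ω => a ω k i) (hb : ∀ k j, Measurable fun ω => b ω k j) :
    Measurable fun ω => trackDist d o p γ (a ω) (b ω) := by
  have hd₂ {u v : Ω → S} (hu : Measurable u) (hv : Measurable v) :
      Measurable fun ω => d (u ω) (v ω) ^ p := (hd.comp (hu.prodMk hv)).pow_const p
  refine Measurable.iInf fun f => (Measurable.add_const ?_ _).pow_const _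
  refine Finset.measurable_sum _ fun k _ =>
    (Finset.measurable_sum _ fun i _ => ?_).add (Finset.measurable_sum _ fun j _ => ?_)
  · cases f k i with
    | none => exact hd₂ (ha k i) measurable_const
    | some j => exact hd₂ (ha k i) (hb k j)
  · cases (f k).symm j with
    | none => exact hd₂ measurable_const (hb k j)
    | some i => exact measurable_const

end TrackDist

section Gospa

variable {E : Type*} {db : E → E → ℝ} {c p ρ : ℝ}

lemma gospaOne_nonneg (hdb : IsQMetric db) (hc : 0 < c) (hρ : 0 < ρ) (hρ' : ρ < 1) :
    ∀ a b, 0 ≤ gospaOne db c p ρ a b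
  | none, none => le_rfl
  | none, some _ => mul_nonneg (Real.rpow_nonneg hρ.le _) hc.le
  | some _, none => mul_nonneg (Real.rpow_nonneg (sub_nonneg.2 hρ'.le) _) hc.le
  | some x, some y => le_min hc.le (hdb.nonneg x y)

lemma gospaOne_eq_zero_iff (hdb : IsQMetric db) (hc : 0 < c) (hρ : 0 < ρ) (hρ' : ρ < 1)
    (a b : Option E) : gospaOne db c p ρ a b = 0 ↔ a = b := by
  have hρc : 0 < ρ ^ (1 / p) * c := mul_pos (Real.rpow_pos_of_pos hρ _) hc
  have hρc' : 0 < (1 - ρ) ^ (1 / p) * c := mul_pos (Real.rpow_pos_of_pos (sub_pos.2 hρ') _) hc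
  rcases a with _ | x <;> rcases b with _ | y
  · simp [gospaOne]
  · simpa only [gospaOne, reduceCtorEq, iff_false] using hρc.ne'
  · simpa only [gospaOne, reduceCtorEq, iff_false] using hρc'.ne'
  · rw [Option.some_inj, ← hdb.eq_zero_iff, gospaOne]
    constructor
    · intro h
      rcases min_choice c (db x y) with h' | h' <;> linarith
    · intro h
      rw [h, min_eq_right hc.le]

lemma one_le_rpow_add_rpow (hp : 1 ≤ p) (hρ : 0 < ρ) (hρ' : ρ < 1) :
    1 ≤ (1 - ρ) ^ (1 / p) + ρ ^ (1 / p) := by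
  have hp' : 1 / p ≤ 1 := by rw [one_div]; exact inv_le_one_of_one_le₀ hp
  calc 1 = (1 - ρ) + ρ := by ring
    _ ≤ _ := add_le_add
      (Real.self_le_rpow_of_le_one (by linarith) (by linarith) hp')
      (Real.self_le_rpow_of_le_one hρ.le hρ'.le hp')

lemma min_add_le_min_add_min {c u v w : ℝ} (hc : 0 ≤ c) (hv : 0 ≤ v) (hw : 0 ≤ w)
    (h : u ≤ v + w) : min c u ≤ min c v + min c w := by
  grind

lemma gospaOne_triangle (hdb : IsQMetric db) (hc : 0 < c) (hp : 1 ≤ p) (hρ : 0 < ρ)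
    (hρ' : ρ < 1) (a b e : Option E) :
    gospaOne db c p ρ a b ≤ gospaOne db c p ρ a e + gospaOne db c p ρ e b := by
  have hnonneg := gospaOne_nonneg (p := p) hdb hc hρ hρ'
  match a, e, b with
  | none, _, none => exact add_nonneg (hnonneg _ _) (hnonneg _ _)
  | none, none, some _ => exact (zero_add _).ge
  | none, some _, some _ => exact le_add_of_nonneg_right (hnonneg _ _)
  | some _, none, none => exact (add_zero _).ge
  | some _, some _, none => exact le_add_of_nonneg_left (hnonneg _ _)
  | some x, none, some y =>
    calc min c (db x y) ≤ 1 * c := by rw [one_mul]; exact min_le_left _ _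
      _ ≤ ((1 - ρ) ^ (1 / p) + ρ ^ (1 / p)) * c :=
        mul_le_mul_of_nonneg_right (one_le_rpow_add_rpow hp hρ hρ') hc.le
      _ = _ := add_mul _ _ _
  | some x, some z, some y =>
    exact min_add_le_min_add_min hc.le (hdb.nonneg x z) (hdb.nonneg z y) (hdb.triangle x y z)

lemma isQMetric_gospaOne (hdb : IsQMetric db) (hc : 0 < c) (hp : 1 ≤ p) (hρ : 0 < ρ)
    (hρ' : ρ < 1) : IsQMetric (gospaOne db c p ρ) :=
  ⟨gospaOne_nonneg hdb hc hρ hρ', gospaOne_eq_zero_iff hdb hc hρ hρ',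
    gospaOne_triangle hdb hc hp hρ hρ'⟩

lemma rpow_one_div_mul_rpow {r : ℝ} (hr : 0 ≤ r) (hc : 0 ≤ c) (hp : p ≠ 0) :
    (r ^ (1 / p) * c) ^ p = r * c ^ p := by
  rw [Real.mul_rpow (Real.rpow_nonneg hr _) hc, one_div, Real.rpow_inv_rpow hr hp]

lemma rpow_one_div_mul_le {r : ℝ} (hr : 0 ≤ r) (hr' : r ≤ 1) (hc : 0 ≤ c) (hp : 0 ≤ p) :
    r ^ (1 / p) * c ≤ c :=
  mul_le_of_le_one_left hc (Real.rpow_le_one hr hr' (by positivity))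

lemma gospaOne_none_le (hc : 0 < c) (hp : 1 ≤ p) (hρ : 0 < ρ) (hρ' : ρ < 1) :
    ∀ b, gospaOne db c p ρ none b ≤ c
  | none => hc.le
  | some _ => rpow_one_div_mul_le hρ.le hρ'.le hc.le (by linarith)

lemma gospaOne_le_none (hc : 0 < c) (hp : 1 ≤ p) (hρ : 0 < ρ) (hρ' : ρ < 1) :
    ∀ a, gospaOne db c p ρ a none ≤ c
  | none => hc.le
  | some _ => rpow_one_div_mul_le (sub_nonneg.2 hρ'.le) (by linarith) hc.le (by linarith)

open Classical in
lemma gospaOne_rpow_eq (hc : 0 < c) (hp : p ≠ 0) (hρ : 0 < ρ) (hρ' : ρ < 1) (a b : Option E) :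
    gospaOne db c p ρ a b ^ p
      = (if a.isSome ∧ b.isSome ∧ gospaOne db c p ρ a b < c
          then gospaOne db c p ρ a b ^ p - c ^ p else 0)
        + ρ * c ^ p * (if b.isSome then 1 else 0)
        + (1 - ρ) * c ^ p * (if a.isSome then 1 else 0) := by
  rcases a with _ | x <;> rcases b with _ | y
  · simp [gospaOne, Real.zero_rpow hp]
  · simpa [gospaOne] using rpow_one_div_mul_rpow hρ.le hc.le hp
  · simpa [gospaOne] using rpow_one_div_mul_rpow (sub_nonneg.2 hρ'.le) hc.le hp
  · by_cases h : gospaOne db c p ρ (some x) (some y) < c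
    · simp only [Option.isSome_some, h, and_self, if_true]
      ring
    · have heq : gospaOne db c p ρ (some x) (some y) = c :=
        le_antisymm (min_le_left _ _) (not_lt.1 h)
      simp only [Option.isSome_some, heq, lt_irrefl, and_false, if_true, if_false]
      ring

end Gospa

section Assignment

variable {T : ℕ} {E : Type*} {X Y : Finset (Trajectory T E)}

/-- The partial matching `f` as an assignment vector. Partial matchings carry their inverse, which
assignment vectors leave implicit. -/
def AssignmentVector.ofPEquiv (f : X ≃. Y) : AssignmentVector X Y :=
  ⟨f, fun _ _ _ h h' => f.inj h h'⟩

lemma AssignmentVector.ofPEquiv_surjective :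
    Function.Surjective (AssignmentVector.ofPEquiv : (X ≃. Y) → AssignmentVector X Y) := by
  classical
  rintro ⟨π, hπ⟩
  refine ⟨⟨π, fun j => if h : ∃ i, π i = some j then some h.choose else none, fun i j => ?_⟩, rfl⟩
  constructor
  · intro hij
    split_ifs at hij with h
    rw [← Option.some.inj hij]
    exact h.choose_spec
  · intro hij
    have h : ∃ i, π i = some j := ⟨i, hij⟩
    rw [dif_pos h, hπ _ _ _ h.choose_spec hij]

variable {db : E → E → ℝ} {c p ρ : ℝ}

lemma stepCost_eq (k : ℕ) (π : AssignmentVector X Y) :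
    stepCost db c p ρ X Y k π
      = ∑ ij ∈ objectAssignment db c p ρ X Y k π,
          (gospaOne db c p ρ (ij.1.1.stateAt k) (ij.2.1.stateAt k) ^ p - c ^ p)
        + ρ * c ^ p * numPresent Y k + (1 - ρ) * c ^ p * numPresent X k := by
  rw [stepCost, Finset.sum_sub_distrib, Finset.sum_const, nsmul_eq_mul]
  ring

open Classical in
lemma numPresent_eq_sum (k : ℕ) :
    (numPresent X k : ℝ) = ∑ i : X, if (i.1.stateAt k).isSome then 1 else 0 := by
  rw [numPresent, ← Finset.sum_coe_sort X]
  push_cast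
  rfl

open Classical in
lemma sum_objectAssignment_ofPEquiv (k : ℕ) (f : X ≃. Y) (F : X → Y → ℝ) :
    ∑ ij ∈ objectAssignment db c p ρ X Y k (.ofPEquiv f), F ij.1 ij.2
      = ∑ i, (f i).elim 0 fun j =>
          if (i.1.stateAt k).isSome ∧ (j.1.stateAt k).isSome ∧
            gospaOne db c p ρ (i.1.stateAt k) (j.1.stateAt k) < c then F i j else 0 := by
  rw [objectAssignment, Finset.sum_filter, Fintype.sum_prod_type]
  refine Finset.sum_congr rfl fun i _ => ?_
  change ∑ j, (if f i = some j ∧ _ then F i j else 0) = _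
  cases f i <;> simp [ite_and]

lemma stepCost_ofPEquiv (hc : 0 < c) (hp : p ≠ 0) (hρ : 0 < ρ) (hρ' : ρ < 1) (k : ℕ)
    (f : X ≃. Y) :
    stepCost db c p ρ X Y k (.ofPEquiv f)
      = matchingCost (gospaOne db c p ρ) none p (fun i : X => i.1.stateAt k)
          (fun j : Y => j.1.stateAt k) f := by
  classical
  let a (x : Option X) : Option E := x.elim none fun i => i.1.stateAt k
  let b (y : Option Y) : Option E := y.elim none fun j => j.1.stateAt k
  let φ (x : Option X) (y : Option Y) : ℝ :=
    if (a x).isSome ∧ (b y).isSome ∧ gospaOne db c p ρ (a x) (b y) < c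
      then gospaOne db c p ρ (a x) (b y) ^ p - c ^ p else 0
  have hassigned : ∑ ij ∈ objectAssignment db c p ρ X Y k (.ofPEquiv f),
      (gospaOne db c p ρ (ij.1.1.stateAt k) (ij.2.1.stateAt k) ^ p - c ^ p) = edgeSum φ f := by
    rw [sum_objectAssignment_ofPEquiv k f fun i j =>
      gospaOne db c p ρ (i.1.stateAt k) (j.1.stateAt k) ^ p - c ^ p, edgeSum]
    have hdummy (j : Y) : (f.symm j).elim (φ none (some j)) (fun _ => 0) = 0 := by
      cases f.symm j <;> simp [φ, a]
    simp only [hdummy, Finset.sum_const_zero, add_zero]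
    refine Finset.sum_congr rfl fun i _ => ?_
    cases f i with
    | none => simp [φ, b]
    | some j => exact if_congr Iff.rfl rfl rfl
  have hright : ρ * c ^ p * numPresent Y k
      = edgeSum (fun _ y => ρ * c ^ p * if (b y).isSome then 1 else 0) f := by
    rw [edgeSum_right (fun y => ρ * c ^ p * if (b y).isSome then 1 else 0) (by simp [b]),
      ← Finset.mul_sum, numPresent_eq_sum]
    rfl
  have hleft : (1 - ρ) * c ^ p * numPresent X k
      = edgeSum (fun x _ => (1 - ρ) * c ^ p * if (a x).isSome then 1 else 0) f := by
    rw [edgeSum_left (fun x => (1 - ρ) * c ^ p * if (a x).isSome then 1 else 0) (by simp [a]),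
      ← Finset.mul_sum, numPresent_eq_sum]
    rfl
  rw [stepCost_eq, hassigned, hright, hleft, ← edgeSum_add, ← edgeSum_add]
  exact congrArg (edgeSum · f) (funext₂ fun x y => (gospaOne_rpow_eq hc hp hρ hρ' _ _).symm)

/-- The trajectories of `X` as a family of tracks: the set of objects of each trajectory at each
time step. The index `k : Fin T` stands for the time step `k + 1`, as in `sequenceCost`. -/
def tracks (X : Finset (Trajectory T E)) (k : Fin T) (i : X) : Option E := i.1.stateAt (k + 1)

lemma sequenceCost_ofPEquiv (hc : 0 < c) (hp : p ≠ 0) (hρ : 0 < ρ) (hρ' : ρ < 1) (γ : ℝ)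
    (f : Fin T → (X ≃. Y)) :
    sequenceCost db c p γ ρ X Y (fun k => .ofPEquiv (f k))
      = trackCost (gospaOne db c p ρ) none p γ (tracks X) (tracks Y) f := by
  simp only [sequenceCost, stepCost_ofPEquiv hc hp hρ hρ', trackCost, numSwitches, Finset.mul_sum,
    switchCost]
  rfl

lemma tgospa_eq_trackDist (hc : 0 < c) (hp : p ≠ 0) (hρ : 0 < ρ) (hρ' : ρ < 1) (γ : ℝ)
    (X Y : Finset (Trajectory T E)) :
    tgospa db c p γ ρ X Y
      = trackDist (gospaOne db c p ρ) none p γ (tracks X) (tracks Y) := by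
  simp only [tgospa, trackDist, ← sequenceCost_ofPEquiv hc hp hρ hρ']
  exact (AssignmentVector.ofPEquiv_surjective.comp_left.iInf_comp
    fun π => sequenceCost db c p γ ρ X Y π ^ (1 / p)).symm

end Assignment

section QMetric

variable {T : ℕ} {E : Type*}

namespace Trajectory

lemma stateAt_isSome_iff (X : Trajectory T E) (k : ℕ) :
    (X.stateAt k).isSome ↔ X.start ≤ k ∧ k < X.start + X.duration := by
  unfold stateAt
  split_ifs with h <;> simp [h]

lemma bounds (X : Trajectory T E) :
    1 ≤ X.start ∧ X.start ≤ T ∧ 1 ≤ X.duration ∧ X.start + X.duration ≤ T + 1 :=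
  X.1.2

lemma ext_stateAt {X Y : Trajectory T E} (h : ∀ k : Fin T, X.stateAt (k + 1) = Y.stateAt (k + 1)) :
    X = Y := by
  replace h (k : ℕ) (hk : 1 ≤ k) (hkT : k ≤ T) : X.stateAt k = Y.stateAt k := by
    simpa [Nat.sub_add_cancel hk] using h ⟨k - 1, by omega⟩
  have halive (k : ℕ) (hk : 1 ≤ k) (hkT : k ≤ T) :
      (X.start ≤ k ∧ k < X.start + X.duration) ↔ (Y.start ≤ k ∧ k < Y.start + Y.duration) := by
    rw [← X.stateAt_isSome_iff, ← Y.stateAt_isSome_iff, h k hk hkT]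
  have hX := X.bounds
  have hY := Y.bounds
  have hstart : X.start = Y.start := by
    have := halive X.start
    have := halive Y.start
    omega
  have hduration : X.duration = Y.duration := by
    have := halive (X.start + X.duration - 1)
    have := halive (Y.start + Y.duration - 1)
    omega
  obtain ⟨⟨⟨w, v⟩, hwv⟩, x⟩ := X
  obtain ⟨⟨⟨w', v'⟩, _⟩, y⟩ := Y
  obtain rfl : w = w' := hstart
  obtain rfl : v = v' := hduration
  simp only at hwv
  congr 1
  funext i
  have hi : (i : ℕ) < v := i.2
  simpa [stateAt, start, duration, hi] using h (w + i) (by omega) (by omega)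

end Trajectory

lemma mem_of_tracks_eq {X Y : Finset (Trajectory T E)} {i : X} {o : Option Y}
    (h : ∀ k, tracks X k i = o.elim none (tracks Y k)) : i.1 ∈ Y := by
  cases o with
  | none =>
    have hb := i.1.bounds
    have hborn : (i.1.stateAt i.1.start).isSome :=
      (i.1.stateAt_isSome_iff _).2 ⟨le_rfl, by omega⟩
    have hnone := h ⟨i.1.start - 1, by omega⟩
    simp only [tracks, Nat.sub_add_cancel hb.1, Option.elim_none] at hnone
    simp [hnone] at hborn
  | some j =>
    rw [Trajectory.ext_stateAt (Y := j.1) h]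
    exact j.2

variable {db : E → E → ℝ} {c p γ ρ : ℝ}

lemma isQMetric_tgospa (hdb : IsQMetric db) (hc : 0 < c) (hp : 1 ≤ p) (hγ : 0 < γ) (hρ : 0 < ρ)
    (hρ' : ρ < 1) : IsQMetric (tgospa db c p γ ρ : Finset (Trajectory T E) → _ → ℝ) := by
  have hp0 : p ≠ 0 := by linarith
  have hgospa := isQMetric_gospaOne hdb hc hp hρ hρ'
  simp only [funext₂ (tgospa_eq_trackDist (T := T) (db := db) hc hp0 hρ hρ' γ)]
  refine ⟨fun X Y => trackDist_nonneg hgospa.nonneg hγ.le _ _, fun X Y => ⟨fun h => ?_, ?_⟩,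
    fun X Y Z => trackDist_triangle hgospa hp hγ.le _ _ _⟩
  · obtain ⟨f, hf⟩ := exists_matching_of_trackDist_eq_zero hgospa hp0 hγ h
    exact Finset.Subset.antisymm (fun x hx => mem_of_tracks_eq fun k => (hf k).1 ⟨x, hx⟩)
      fun y hy => mem_of_tracks_eq fun k => (hf k).2 ⟨y, hy⟩
  · rintro rfl
    exact trackDist_comp_equiv_self hgospa hp0 hγ.le (tracks X) (.refl X)

lemma tgospa_le (hdb : IsQMetric db) (hc : 0 < c) (hp : 1 ≤ p) (hρ : 0 < ρ) (hρ' : ρ < 1)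
    (X Y : Finset (Trajectory T E)) :
    tgospa db c p γ ρ X Y
      ≤ (T * c ^ p) ^ (1 / p) * ((X.card : ℝ) ^ (1 / p) + (Y.card : ℝ) ^ (1 / p)) := by
  have hp0 : p ≠ 0 := by linarith
  have hp' : 1 / p ≤ 1 := by rw [one_div]; exact inv_le_one_of_one_le₀ hp
  have hTc : 0 ≤ T * c ^ p := by positivity
  rw [tgospa_eq_trackDist hc hp0 hρ hρ']
  calc _ ≤ (T * c ^ p * (X.card + Y.card)) ^ (1 / p) := by
        simpa using trackDist_le_of_le (γ := γ) (gospaOne_nonneg hdb hc hρ hρ') (by linarith)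
          (gospaOne_le_none hc hp hρ hρ') (gospaOne_none_le hc hp hρ hρ') (tracks X) (tracks Y)
    _ = (T * c ^ p) ^ (1 / p) * (X.card + Y.card : ℝ) ^ (1 / p) :=
        Real.mul_rpow hTc (by positivity)
    _ ≤ _ := by
        gcongr
        exact Real.rpow_add_le_add_rpow (by positivity) (by positivity) (by positivity) hp'

end QMetric

section FiniteSetMeasurability

open ProbabilityTheory

variable {F : Type*} {n : ℕ} {s : Finset F}

/-- The `n`-tuples of pairwise distinct points of `F`: the enumerations of the `n`-point subsets
of `F`. -/
abbrev InjectiveTuple (n : ℕ) (F : Type*) : Type _ :=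
  {x : Fin n → F // Function.Injective x}

/-- The finite set of the entries of an injective tuple. -/
def finsetOfTuple (x : InjectiveTuple n F) : Finset F :=
  Finset.univ.map ⟨x.1, x.2⟩

/-- The enumeration of a finite set given by a bijection with `Fin n`. -/
def tupleOfEquiv (e : Fin n ≃ s) : InjectiveTuple n F :=
  ⟨fun i => e i, Subtype.val_injective.comp e.injective⟩

lemma finsetOfTuple_tupleOfEquiv (e : Fin n ≃ s) : finsetOfTuple (tupleOfEquiv e) = s := by
  ext y
  simp only [finsetOfTuple, tupleOfEquiv, Finset.mem_map, Finset.mem_univ, true_and,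
    Function.Embedding.coeFn_mk]
  exact ⟨fun ⟨i, hi⟩ => hi ▸ (e i).2, fun hy => ⟨e.symm ⟨y, hy⟩, by simp⟩⟩

/-- The bijection through which an injective tuple enumerates the set of its entries. -/
def equivFinsetOfTuple (x : InjectiveTuple n F) : Fin n ≃ finsetOfTuple x :=
  Equiv.ofBijective (fun i => ⟨x.1 i, Finset.mem_map_of_mem _ (Finset.mem_univ i)⟩)
    ⟨fun _ _ h => x.2 (congrArg Subtype.val h), fun y => by
      obtain ⟨i, -, hi⟩ := Finset.mem_map.1 y.2
      exact ⟨i, Subtype.ext hi⟩⟩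

open Classical in
lemma sum_tupleOfEquiv_finsetOfTuple {M : Type*} [AddCommMonoid M] (φ : InjectiveTuple n F → M)
    (x : InjectiveTuple n F) :
    ∑ e : Fin n ≃ finsetOfTuple x, φ (tupleOfEquiv e)
      = ∑ σ : Equiv.Perm (Fin n), φ ⟨x.1 ∘ σ, x.2.comp σ.injective⟩ := by
  rw [← ((Equiv.refl (Fin n)).equivCongr (equivFinsetOfTuple x)).sum_comp]
  rfl

variable [MeasurableSpace F] {β : Type*} [MeasurableSpace β]

lemma measurable_finiteSetSigma_iff {g : Finset F → β} :
    Measurable[finiteSetSigma F] g ↔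
      ∀ n, Measurable fun x : InjectiveTuple n F => g (finsetOfTuple x) :=
  ⟨fun h n _ ht => MeasurableSpace.measurableSet_iInf.1 (h ht) n,
    fun h _ ht => MeasurableSpace.measurableSet_iInf.2 fun n => h n ht⟩

open Classical in
/-- The counting measure on the enumerations of a finite set by `Fin n`; it vanishes unless the
set has `n` elements. As `s` varies it is a kernel, which replaces a measurable selection of an
enumeration. -/
def enumMeasure (n : ℕ) (s : Finset F) : Measure (InjectiveTuple n F) :=
  ∑ e : Fin n ≃ s, Measure.dirac (tupleOfEquiv e)

open Classical in
lemma enumMeasure_apply (n : ℕ) (s : Finset F) {B : Set (InjectiveTuple n F)}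
    (hB : MeasurableSet B) :
    enumMeasure n s B = ∑ e : Fin n ≃ s, B.indicator 1 (tupleOfEquiv e) := by
  simp only [enumMeasure, Measure.finsetSum_apply, Measure.dirac_apply' _ hB]

lemma enumMeasure_ne_zero_iff {B : Set (InjectiveTuple n F)} (hB : MeasurableSet B) :
    enumMeasure n s B ≠ 0 ↔ ∃ e : Fin n ≃ s, tupleOfEquiv e ∈ B := by
  classical
  simp [enumMeasure_apply n s hB, Finset.sum_eq_zero_iff]

lemma enumMeasure_univ_le (n : ℕ) (s : Finset F) :
    enumMeasure n s Set.univ ≤ (n.factorial : ENNReal) := by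
  classical
  simp only [enumMeasure_apply n s MeasurableSet.univ, Set.indicator_univ, Pi.one_apply,
    Finset.sum_const, Finset.card_univ, nsmul_eq_mul, mul_one]
  rcases isEmpty_or_nonempty (Fin n ≃ s) with _ | ⟨⟨e⟩⟩
  · simp
  · rw [Fintype.card_equiv e, Fintype.card_fin]

lemma measurable_enumMeasure (n : ℕ) : Measurable[finiteSetSigma F] (enumMeasure (F := F) n) := by
  classical
  refine measurable_finiteSetSigma_iff.2 fun m => Measure.measurable_of_measurable_coe _
    fun B hB => ?_
  simp only [enumMeasure_apply n _ hB]
  obtain rfl | hmn := eq_or_ne m n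
  · simp only [sum_tupleOfEquiv_finsetOfTuple]
    refine Finset.measurable_fun_sum _ fun σ _ => (measurable_one.indicator hB).comp ?_
    refine Measurable.subtype_mk (measurable_pi_lambda _ fun i => ?_)
    exact (measurable_pi_apply (σ i)).comp measurable_subtype_coe
  · have hempty (x : InjectiveTuple m F) : IsEmpty (Fin n ≃ finsetOfTuple x) :=
      ⟨fun e => hmn (by simpa using Fintype.card_congr ((equivFinsetOfTuple x).trans e.symm))⟩
    simp only [Finset.univ_eq_empty, Finset.sum_empty]
    exact measurable_const

lemma measurable_finset_comp {Ω : Type*} [MeasurableSpace Ω] {g : Ω → Finset F → β}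
    (hg : ∀ n, Measurable fun z : Ω × InjectiveTuple n F => g z.1 (finsetOfTuple z.2))
    {X : Ω → Finset F} (hX : Measurable[_, finiteSetSigma F] X) :
    Measurable fun ω => g ω (X ω) := by
  intro S hS
  let κ (n : ℕ) : Kernel Ω (InjectiveTuple n F) :=
    ⟨fun ω => enumMeasure n (X ω), (measurable_enumMeasure n).comp hX⟩
  have hκ (n : ℕ) : IsFiniteKernel (κ n) :=
    ⟨⟨n.factorial, ENNReal.natCast_lt_top _, fun ω => enumMeasure_univ_le n (X ω)⟩⟩
  let A (n : ℕ) : Set (Ω × InjectiveTuple n F) := (fun z => g z.1 (finsetOfTuple z.2)) ⁻¹' S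
  have hA (n : ℕ) : MeasurableSet (A n) := hg n hS
  have hset : (fun ω => g ω (X ω)) ⁻¹' S = ⋃ n, {ω | κ n ω (Prod.mk ω ⁻¹' A n) ≠ 0} := by
    ext ω
    have hpos (n : ℕ) : κ n ω (Prod.mk ω ⁻¹' A n) ≠ 0 ↔ Nonempty (Fin n ≃ X ω) ∧ g ω (X ω) ∈ S :=
      (enumMeasure_ne_zero_iff (measurable_prodMk_left (hA n))).trans (by
        simp [A, finsetOfTuple_tupleOfEquiv])
    have henum : ∃ n, Nonempty (Fin n ≃ X ω) := ⟨_, ⟨(X ω).equivFin.symm⟩⟩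
    simp [hpos, henum]
  rw [hset]
  exact MeasurableSet.iUnion fun n =>
    Kernel.measurable_kernel_prodMk_left (hA n) (measurableSet_singleton 0).compl

end FiniteSetMeasurability

section TGOSPAMeasurability

variable {T : ℕ} {E : Type*} [MeasurableSpace E]

/-- The σ-algebra of the disjoint union of `E` and a point, for sets with at most one element. -/
instance optionMeasurableSpace : MeasurableSpace (Option E) :=
  MeasurableSpace.map some inferInstance

lemma measurable_option_some : Measurable (some : E → Option E) :=
  fun _ h => h

lemma measurable_option_getD (x₀ : E) : Measurable fun a : Option E => a.getD x₀ :=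
  fun _ h => h

lemma measurableSet_option_isSome : MeasurableSet {a : Option E | a.isSome} :=
  show MeasurableSet {x : E | (some x).isSome} by simp

lemma measurable_sigma_iff {α β : Type*} {γ : α → Type*} [∀ a, MeasurableSpace (γ a)]
    [MeasurableSpace β] {g : (Σ a, γ a) → β} :
    Measurable g ↔ ∀ a, Measurable fun x : γ a => g ⟨a, x⟩ :=
  ⟨fun h a _ ht => MeasurableSpace.measurableSet_iInf.1 (h ht) a,
    fun h _ ht => MeasurableSpace.measurableSet_iInf.2 fun a => h a ht⟩

lemma Trajectory.measurable_stateAt (k : ℕ) :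
    Measurable fun X : Trajectory T E => X.stateAt k := by
  refine measurable_sigma_iff.2 fun s => ?_
  by_cases h : s.1.1 ≤ k ∧ k < s.1.1 + s.1.2
  · have hsome : (fun x => stateAt (T := T) ⟨s, x⟩ k) = fun x : Fin s.1.2 → E =>
        some (x ⟨k - s.1.1, by omega⟩) := funext fun _ => dif_pos h
    rw [hsome]
    exact measurable_option_some.comp (measurable_pi_apply _)
  · have hnone : (fun x : Fin s.1.2 → E => stateAt (T := T) ⟨s, x⟩ k) = fun _ => none :=
      funext fun _ => dif_neg h
    rw [hnone]
    exact measurable_const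

lemma measurable_gospaOne {db : E → E → ℝ} (hdb : Measurable (Function.uncurry db)) (c p ρ : ℝ) :
    Measurable (Function.uncurry (gospaOne db c p ρ)) := by
  rcases isEmpty_or_nonempty E with _ | ⟨⟨x₀⟩⟩
  · exact Subsingleton.measurable
  have hite : Function.uncurry (gospaOne db c p ρ) = fun z =>
      if z.1.isSome then
        if z.2.isSome then min c (db (z.1.getD x₀) (z.2.getD x₀)) else (1 - ρ) ^ (1 / p) * c
      else if z.2.isSome then ρ ^ (1 / p) * c else 0 := by
    ext ⟨_ | x, _ | y⟩ <;> simp [gospaOne]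
  have hsome₁ : MeasurableSet {z : Option E × Option E | z.1.isSome} :=
    measurable_fst measurableSet_option_isSome
  have hsome₂ : MeasurableSet {z : Option E × Option E | z.2.isSome} :=
    measurable_snd measurableSet_option_isSome
  have hbase : Measurable fun z : Option E × Option E => db (z.1.getD x₀) (z.2.getD x₀) :=
    hdb.comp (((measurable_option_getD x₀).comp measurable_fst).prodMk
      ((measurable_option_getD x₀).comp measurable_snd))
  rw [hite]
  exact .ite hsome₁ (.ite hsome₂ (measurable_const.min hbase) measurable_const)
    (.ite hsome₂ measurable_const measurable_const)

lemma measurable_tgospa_finsetOfTuple {db : E → E → ℝ} (hdb : IsQMetric db)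
    (hdb_meas : Measurable (Function.uncurry db)) {c p γ ρ : ℝ} (hc : 0 < c) (hp : 1 ≤ p)
    (hγ : 0 ≤ γ) (hρ : 0 < ρ) (hρ' : ρ < 1) (n m : ℕ) :
    Measurable fun z : InjectiveTuple n (Trajectory T E) × InjectiveTuple m (Trajectory T E) =>
      tgospa db c p γ ρ (finsetOfTuple z.1) (finsetOfTuple z.2) := by
  have henum (z : InjectiveTuple n (Trajectory T E) × InjectiveTuple m (Trajectory T E)) :
      tgospa db c p γ ρ (finsetOfTuple z.1) (finsetOfTuple z.2)
        = trackDist (gospaOne db c p ρ) none p γ (fun (k : Fin T) i => (z.1.1 i).stateAt (k + 1))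
            (fun k j => (z.2.1 j).stateAt (k + 1)) := by
    rw [tgospa_eq_trackDist hc (by linarith) hρ hρ']
    exact (trackDist_comp_equiv (isQMetric_gospaOne hdb hc hp hρ hρ') hp hγ _ _
      (equivFinsetOfTuple z.1) (equivFinsetOfTuple z.2)).symm
  simp only [henum]
  refine measurable_trackDist (measurable_gospaOne hdb_meas c p ρ) (fun k i => ?_) fun k j => ?_
  · exact (Trajectory.measurable_stateAt _).comp
      ((measurable_pi_apply i).comp (measurable_subtype_coe.comp measurable_fst))
  · exact (Trajectory.measurable_stateAt _).comp
      ((measurable_pi_apply j).comp (measurable_subtype_coe.comp measurable_snd))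

lemma measurable_tgospa_comp {Ω : Type*} [MeasurableSpace Ω] {db : E → E → ℝ} (hdb : IsQMetric db)
    (hdb_meas : Measurable (Function.uncurry db)) {c p γ ρ : ℝ} (hc : 0 < c) (hp : 1 ≤ p)
    (hγ : 0 ≤ γ) (hρ : 0 < ρ) (hρ' : ρ < 1) {X Y : Ω → Finset (Trajectory T E)}
    (hX : Measurable[_, finiteSetSigma (Trajectory T E)] X)
    (hY : Measurable[_, finiteSetSigma (Trajectory T E)] Y) :
    Measurable fun ω => tgospa db c p γ ρ (X ω) (Y ω) := by
  have hpair (m : ℕ) : Measurable fun z : Ω × InjectiveTuple m (Trajectory T E) =>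
      tgospa db c p γ ρ (X z.1) (finsetOfTuple z.2) := by
    have hswap (n : ℕ) : Measurable fun z : (Ω × InjectiveTuple m (Trajectory T E)) ×
        InjectiveTuple n (Trajectory T E) => (z.2, z.1.2) := by fun_prop
    have htuple (n : ℕ) :=
      (measurable_tgospa_finsetOfTuple (T := T) hdb hdb_meas hc hp hγ hρ hρ' n m).comp (hswap n)
    exact measurable_finset_comp (g := fun (z : Ω × InjectiveTuple m (Trajectory T E)) Z =>
      tgospa db c p γ ρ Z (finsetOfTuple z.2)) htuple (hX.comp measurable_fst)
  exact measurable_finset_comp (g := fun ω Z => tgospa db c p γ ρ (X ω) Z) hpair hY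

end TGOSPAMeasurability

section RandomFiniteSets

variable {Ω : Type*} [MeasurableSpace Ω] {P : Measure Ω} {T : ℕ} {E : Type*} [MeasurableSpace E]
  {db : E → E → ℝ} {c p γ ρ p' : ℝ}

lemma measurable_finset_card {F : Type*} [MeasurableSpace F] :
    Measurable[finiteSetSigma F] (Finset.card : Finset F → ℕ) :=
  measurable_finiteSetSigma_iff.2 fun n => by
    simp only [finsetOfTuple, Finset.card_map]
    exact measurable_const

lemma TrajectoryRFS.memLp_card (hp' : 0 < p') (X : TrajectoryRFS P T E (p' / p)) :
    MemLp (fun ω => ((X.toFun ω).card : ℝ) ^ (1 / p)) (.ofReal p') P := by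
  have hmeas : Measurable fun ω => ((X.toFun ω).card : ℝ) ^ (1 / p) :=
    (measurable_from_top.comp (measurable_finset_card.comp X.measurable)).pow_const _
  have hpow (m : ℕ) : ‖(m : ℝ) ^ (1 / p)‖ ^ p' = (m : ℝ) ^ (p' / p) := by
    rw [Real.norm_of_nonneg (by positivity), ← Real.rpow_mul (by positivity), one_div_mul_eq_div]
  rw [← integrable_norm_rpow_iff hmeas.aestronglyMeasurable (by simpa) ENNReal.ofReal_ne_top]
  simpa only [ENNReal.toReal_ofReal hp'.le, hpow] using X.moment

lemma memLp_tgospa (hdb : IsQMetric db) (hdb_meas : Measurable (Function.uncurry db))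
    (hc : 0 < c) (hp : 1 ≤ p) (hγ : 0 < γ) (hρ : 0 < ρ) (hρ' : ρ < 1) (hp' : 0 < p')
    (X Y : TrajectoryRFS P T E (p' / p)) :
    MemLp (fun ω => tgospa db c p γ ρ (X.toFun ω) (Y.toFun ω)) (.ofReal p') P := by
  refine (((X.memLp_card hp').add (Y.memLp_card hp')).const_mul ((T * c ^ p) ^ (1 / p))).mono
    (measurable_tgospa_comp hdb hdb_meas hc hp hγ.le hρ hρ' X.measurable
      Y.measurable).aestronglyMeasurable (.of_forall fun ω => ?_)
  rw [Real.norm_of_nonneg ((isQMetric_tgospa hdb hc hp hγ hρ hρ').nonneg _ _)]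
  exact (tgospa_le hdb hc hp hρ hρ' _ _).trans (le_abs_self _)

lemma integral_rpow_rpow_eq_lpNorm {f : Ω → ℝ} (hf : MemLp f (.ofReal p') P) (hf0 : ∀ ω, 0 ≤ f ω)
    (hp' : 0 < p') : (∫ ω, f ω ^ p' ∂P) ^ (1 / p') = lpNorm f (.ofReal p') P := by
  rw [lpNorm_eq_integral_norm_rpow_toReal (by simpa) ENNReal.ofReal_ne_top hf.1,
    ENNReal.toReal_ofReal hp'.le, one_div]
  simp only [Real.norm_of_nonneg (hf0 _)]

lemma integrable_rpow_of_memLp {f : Ω → ℝ} (hf : MemLp f (.ofReal p') P) (hf0 : ∀ ω, 0 ≤ f ω)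
    (hp' : 0 < p') : Integrable (fun ω => f ω ^ p') P := by
  simpa only [Real.norm_of_nonneg (hf0 _), ENNReal.toReal_ofReal hp'.le] using
    hf.integrable_norm_rpow (by simpa) ENNReal.ofReal_ne_top

lemma rfsDist_eq_lpNorm (hdb : IsQMetric db) (hdb_meas : Measurable (Function.uncurry db))
    (hc : 0 < c) (hp : 1 ≤ p) (hγ : 0 < γ) (hρ : 0 < ρ) (hρ' : ρ < 1) (hp' : 0 < p')
    (X Y : TrajectoryRFS P T E (p' / p)) : rfsDist db c p γ ρ p' X Y
      = lpNorm (fun ω => tgospa db c p γ ρ (X.toFun ω) (Y.toFun ω)) (.ofReal p') P :=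
  integral_rpow_rpow_eq_lpNorm (memLp_tgospa hdb hdb_meas hc hp hγ hρ hρ' hp' X Y)
    (fun _ => (isQMetric_tgospa hdb hc hp hγ hρ hρ').nonneg _ _) hp'

lemma rfsDist_eq_zero_iff (hdb : IsQMetric db) (hdb_meas : Measurable (Function.uncurry db))
    (hc : 0 < c) (hp : 1 ≤ p) (hγ : 0 < γ) (hρ : 0 < ρ) (hρ' : ρ < 1) (hp' : 0 < p')
    (X Y : TrajectoryRFS P T E (p' / p)) :
    rfsDist db c p γ ρ p' X Y = 0 ↔ X.toFun =ᵐ[P] Y.toFun := by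
  rw [rfsDist_eq_lpNorm hdb hdb_meas hc hp hγ hρ hρ' hp', lpNorm_eq_zero
    (memLp_tgospa hdb hdb_meas hc hp hγ hρ hρ' hp' X Y) (by simpa)]
  exact Filter.eventually_congr (.of_forall fun _ =>
    (isQMetric_tgospa hdb hc hp hγ hρ hρ').eq_zero_iff _ _)

lemma rfsDist_triangle (hdb : IsQMetric db) (hdb_meas : Measurable (Function.uncurry db))
    (hc : 0 < c) (hp : 1 ≤ p) (hγ : 0 < γ) (hρ : 0 < ρ) (hρ' : ρ < 1) (hp' : 1 ≤ p')
    (X Y Z : TrajectoryRFS P T E (p' / p)) :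
    rfsDist db c p γ ρ p' X Y ≤ rfsDist db c p γ ρ p' X Z + rfsDist db c p γ ρ p' Z Y := by
  have hd := isQMetric_tgospa (T := T) hdb hc hp hγ hρ hρ'
  have hLp := memLp_tgospa (P := P) (T := T) hdb hdb_meas hc hp hγ hρ hρ' (p' := p') (by linarith)
  have hnorm := rfsDist_eq_lpNorm (P := P) (T := T) hdb hdb_meas hc hp hγ hρ hρ' (p' := p')
    (by linarith)
  simp only [hnorm]
  refine (lpNorm_mono_real ((hLp X Z).add (hLp Z Y)) fun ω => ?_).trans
    (lpNorm_add_le (hLp X Z) (by simpa))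
  rw [Real.norm_of_nonneg (hd.nonneg _ _)]
  exact hd.triangle _ _ _

end RandomFiniteSets

end

theorem lemma10_general {Ω : Type*} [MeasurableSpace Ω] (P : Measure Ω)
    (T : ℕ) {E : Type*} [MeasurableSpace E]
    (db : E → E → ℝ) (hdb : IsQMetric db) (hdb_meas : Measurable (Function.uncurry db))
    (c p γ ρ p' : ℝ) (hc : 0 < c) (hp : 1 ≤ p) (hγ : 0 < γ) (hρ : 0 < ρ) (hρ' : ρ < 1)
    (hp' : 1 ≤ p') :
    (∀ X Y : TrajectoryRFS P T E (p' / p),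
        Integrable (fun ω => tgospa db c p γ ρ (X.toFun ω) (Y.toFun ω) ^ p') P) ∧
      IsQMetric (rfsQDist db c p γ ρ p' :
        RFSSpace P T E (p' / p) → RFSSpace P T E (p' / p) → ℝ) := by
  have hp0 : 0 < p' := by linarith
  have hd := isQMetric_tgospa (T := T) hdb hc hp hγ hρ hρ'
  refine ⟨fun X Y => ?_, Quotient.ind₂ fun X Y => ?_, Quotient.ind₂ fun X Y => ?_,
    fun X Y Z => Quotient.inductionOn₃ X Y Z fun X Y Z => ?_⟩
  · exact integrable_rpow_of_memLp (memLp_tgospa hdb hdb_meas hc hp hγ hρ hρ' hp0 X Y)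
      (fun _ => hd.nonneg _ _) hp0
  · exact Real.rpow_nonneg (integral_nonneg fun _ => Real.rpow_nonneg (hd.nonneg _ _) _) _
  · exact (rfsDist_eq_zero_iff hdb hdb_meas hc hp hγ hρ hρ' hp0 X Y).trans
      (Quotient.eq (r := TrajectoryRFS.setoid P T E (p' / p))).symm
  · exact rfsDist_triangle hdb hdb_meas hc hp hγ hρ hρ' hp' X Y Z

theorem lemma10 {Ω : Type*} [MeasurableSpace Ω] (P : Measure Ω) [IsProbabilityMeasure P]
    (T : ℕ) {E : Type*} [MeasurableSpace E]
    (db : E → E → ℝ) (hdb : IsQMetric db) (hdb_meas : Measurable (Function.uncurry db))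
    (c p γ ρ p' : ℝ) (hc : 0 < c) (hp : 1 ≤ p) (hγ : 0 < γ) (hρ : 0 < ρ) (hρ' : ρ < 1)
    (hp' : 1 ≤ p') :
    (∀ X Y : TrajectoryRFS P T E (p' / p),
        Integrable (fun ω => tgospa db c p γ ρ (X.toFun ω) (Y.toFun ω) ^ p') P) ∧
      IsQMetric (rfsQDist db c p γ ρ p' :
        RFSSpace P T E (p' / p) → RFSSpace P T E (p' / p) → ℝ) :=
  lemma10_general P T db hdb hdb_meas c p γ ρ p' hc hp hγ hρ hρ' hp'
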